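/- Throughout, $\log$ denotes the logarithm to base $2$. There is an absolute constant $C>0$ such that the following holds. Let $m,n$ be positive integers, let $A\in\mathbb{Z}^{m\times n}$ and $b\in\mathbb{Z}^m$, and let $\Delta=\max_{i,j}|A_{ij}|$ be the largest absolute value of an entry of $A$. Assume that $m\Delta\ge 2$. Let $$\mathcal{P}=\{x\in\mathbb{R}^n \mid Ax=b,\ x\ge 0\}$$ (not assumed to be bounded), and let $\mathcal{P}_I=\operatorname{Conv}(\mathcal{P}\cap\mathbb{Z}^n)$ be its integer hull. A point $v\in\mathcal{P}_I$ is called a vertex of $\mathcal{P}_I$ if $v\notin\operatorname{Conv}(\mathcal{P}_I\setminus\{v\})$. Then $\mathcal{P}_I$ has only finitely many vertices, and their number is at most $$\bigl(n\cdot m\cdot\log(m\Delta)\bigr)^{C\,m\log(\sqrt{m}\,\Delta)}.$$ -/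

import Mathlib

/-- The polyhedron `{x ∈ ℝⁿ | A x = b, x ≥ 0}` (not assumed to be bounded). -/
def standardPolyhedron {m n : ℕ} (A : Matrix (Fin m) (Fin n) ℤ) (b : Fin m → ℤ) :
    Set (Fin n → ℝ) :=
  {x | (A.map (Int.cast : ℤ → ℝ)).mulVec x = (fun i => (b i : ℝ)) ∧ ∀ j, 0 ≤ x j}

/-- The lattice `ℤⁿ` as a subset of `ℝⁿ`. -/
def integerPoints (n : ℕ) : Set (Fin n → ℝ) :=
  {x | ∃ z : Fin n → ℤ, ∀ j, x j = (z j : ℝ)}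

/-- The integer hull of a subset `P` of `ℝⁿ`: the convex hull of `P ∩ ℤⁿ`. -/
def integerHull {n : ℕ} (P : Set (Fin n → ℝ)) : Set (Fin n → ℝ) :=
  convexHull ℝ (P ∩ integerPoints n)

/-- The vertices of `Q`: the points of `Q` that are not a convex combination of other
points of `Q`. -/
def vertices {n : ℕ} (Q : Set (Fin n → ℝ)) : Set (Fin n → ℝ) :=
  {v | v ∈ Q ∧ v ∉ convexHull ℝ (Q \ {v})}

/-- The largest absolute value of an entry of the integer matrix `A`
(`0` if there is no entry). -/
def maxAbsEntry {m n : ℕ} (A : Matrix (Fin m) (Fin n) ℤ) : ℕ :=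
  Finset.univ.sup fun i : Fin m => Finset.univ.sup fun j : Fin n => (A i j).natAbs

/-! A vertex is an integer point `z`, and no nonzero integral kernel vector `p` satisfies `|p| ≤ z`,
since otherwise `z` is the midpoint of `z ± p`. Two consequences give the count. Sparsity
(`two_pow_card_support_le`): distinct subsets of the support have distinct column sums, so the
support has size `O(m log(mΔ))`. Rigidity (`eq_of_size_min_eq`): a vertex is determined by the bit
lengths of its coordinates truncated at `2 ^ k`, where `k` is polynomial in `n` and `log Δ`. If two
vertices share them, their difference `w` is either dominated by one of them or has a huge entry. In
the latter case Dirichlet approximation of `w` gives a short nonzero kernel vector that is still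
dominated. It remains to count sparse vectors of bit lengths. -/

/-- No nonzero integer vector of the kernel of `A` is bounded in absolute value by `z`. -/
def KernelFree {m n : ℕ} (A : Matrix (Fin m) (Fin n) ℤ) (z : Fin n → ℕ) : Prop :=
  ∀ p : Fin n → ℤ, A.mulVec p = 0 → (∀ j, |p j| ≤ (z j : ℤ)) → p = 0

theorem abs_le_maxAbsEntry {m n : ℕ} (A : Matrix (Fin m) (Fin n) ℤ) (i : Fin m) (j : Fin n) :
    |A i j| ≤ (maxAbsEntry A : ℤ) := by
  have h1 : (A i j).natAbs ≤ Finset.univ.sup fun j : Fin n => (A i j).natAbs :=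
    Finset.le_sup (f := fun j : Fin n => (A i j).natAbs) (Finset.mem_univ j)
  have h2 : (Finset.univ.sup fun j : Fin n => (A i j).natAbs) ≤ maxAbsEntry A :=
    Finset.le_sup (f := fun i : Fin m => Finset.univ.sup fun j : Fin n => (A i j).natAbs)
      (Finset.mem_univ i)
  rw [Int.abs_eq_natAbs]
  exact_mod_cast h1.trans h2

theorem mem_of_mem_vertices_integerHull {n : ℕ} {P : Set (Fin n → ℝ)} {v : Fin n → ℝ}
    (hv : v ∈ vertices (integerHull P)) : v ∈ P ∩ integerPoints n := by
  by_contra h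
  refine hv.2 (convexHull_mono (fun x hx => ?_) hv.1)
  exact ⟨subset_convexHull ℝ _ hx, fun hxv => h (Set.mem_singleton_iff.1 hxv ▸ hx)⟩

theorem map_mulVec_intCast {m n : ℕ} (A : Matrix (Fin m) (Fin n) ℤ) (z : Fin n → ℤ) :
    (A.map (Int.cast : ℤ → ℝ)).mulVec (fun j => (z j : ℝ)) = fun i => ((A.mulVec z i : ℤ) : ℝ) := by
  ext i
  simp [Matrix.mulVec, dotProduct]

theorem intCast_mem_integerHull {m n : ℕ} {A : Matrix (Fin m) (Fin n) ℤ} {b : Fin m → ℤ}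
    {z : Fin n → ℤ} (hz : A.mulVec z = b) (hz0 : ∀ j, 0 ≤ z j) :
    (fun j => (z j : ℝ)) ∈ integerHull (standardPolyhedron A b) := by
  refine subset_convexHull ℝ _ ⟨⟨?_, fun j => Int.cast_nonneg (hz0 j)⟩, z, fun j => rfl⟩
  rw [map_mulVec_intCast, hz]

theorem exists_kernelFree_of_mem_vertices {m n : ℕ} {A : Matrix (Fin m) (Fin n) ℤ}
    {b : Fin m → ℤ} {v : Fin n → ℝ} (hv : v ∈ vertices (integerHull (standardPolyhedron A b))) :
    ∃ z : Fin n → ℕ, v = (fun j => (z j : ℝ)) ∧ A.mulVec (fun j => (z j : ℤ)) = b ∧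
      KernelFree A z := by
  obtain ⟨⟨hvA, hv0⟩, y, hy⟩ := mem_of_mem_vertices_integerHull hv
  have hy0 : ∀ j, 0 ≤ y j := fun j => by
    have := hv0 j
    rw [hy j] at this
    exact_mod_cast this
  have hvy : v = fun j => (y j : ℝ) := funext hy
  have hcast : (fun j => ((y j).toNat : ℤ)) = y := funext fun j => Int.toNat_of_nonneg (hy0 j)
  have hAy : A.mulVec y = b := by
    rw [hvy, map_mulVec_intCast] at hvA
    ext i
    exact_mod_cast congrFun hvA i
  refine ⟨fun j => (y j).toNat, ?_, by rw [hcast, hAy], fun p hp hpy => ?_⟩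
  · rw [hvy]
    ext j
    exact_mod_cast (congrFun hcast j).symm
  · have hpy' : ∀ j, |p j| ≤ y j := fun j => (hpy j).trans_eq (congrFun hcast j)
    by_contra hne
    obtain ⟨j, hj⟩ := Function.ne_iff.1 hne
    have hj' : (p j : ℝ) ≠ 0 := by exact_mod_cast hj
    have h1 := intCast_mem_integerHull (z := y + p) (by rw [Matrix.mulVec_add, hAy, hp, add_zero])
      (fun j => by have := abs_le.1 (hpy' j); simp only [Pi.add_apply]; linarith)
    have h2 := intCast_mem_integerHull (z := y - p) (by rw [Matrix.mulVec_sub, hAy, hp, sub_zero])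
      (fun j => by have := abs_le.1 (hpy' j); simp only [Pi.sub_apply]; linarith)
    refine hv.2 ?_
    have h3 := (convex_convexHull ℝ (integerHull (standardPolyhedron A b) \ {v}))
      (subset_convexHull ℝ _ ⟨h1, fun h => ?_⟩) (subset_convexHull ℝ _ ⟨h2, fun h => ?_⟩)
      (by norm_num : (0 : ℝ) ≤ 1 / 2) (by norm_num : (0 : ℝ) ≤ 1 / 2) (by norm_num)
    · convert h3 using 1
      ext j
      simp [hvy]
      ring
    · have := congrFun (Set.mem_singleton_iff.1 h) j
      simp [hvy] at this
      exact hj this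
    · have := congrFun (Set.mem_singleton_iff.1 h) j
      simp [hvy] at this
      exact hj this

/-! ### Simultaneous Diophantine approximation in the kernel -/

/-- A kernel vector `w` of `A` is simultaneously approximated by a kernel vector `p` with small
denominator `q`. -/
theorem exists_kernel_approx {m n : ℕ} {A : Matrix (Fin m) (Fin n) ℤ} {Δ D : ℕ}
    (hA : ∀ i j, |A i j| ≤ (Δ : ℤ)) (hD : n * Δ < D) {w : Fin n → ℤ} (hw : A.mulVec w = 0)
    {X : ℤ} (hX : 0 < X) :
    ∃ (p : Fin n → ℤ) (q : ℤ), A.mulVec p = 0 ∧ 0 < q ∧ q ≤ (D : ℤ) ^ n ∧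
      ∀ j, |p j * X - q * w j| * D < X := by
  have hD0 : (0 : ℤ) < D := by exact_mod_cast (Nat.zero_le _).trans_lt hD
  -- Dirichlet's pigeonhole: the fractional parts of `t * w / X` fall into `D ^ n` boxes of side `1
  -- / D`.
  let cell : ℕ → Fin n → ℤ := fun t j => ((t * w j) % X) * D / X
  have hmaps : ∀ t ∈ Finset.range (D ^ n + 1),
      cell t ∈ Fintype.piFinset fun _ : Fin n => Finset.Ico (0 : ℤ) D := by
    intro t _
    refine Fintype.mem_piFinset.2 fun j => Finset.mem_Ico.2 ⟨?_, ?_⟩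
    · exact Int.ediv_nonneg (mul_nonneg (Int.emod_nonneg _ hX.ne') hD0.le) hX.le
    · refine Int.ediv_lt_of_lt_mul hX ?_
      rw [mul_comm (D : ℤ)]
      exact mul_lt_mul_of_pos_right (Int.emod_lt_of_pos _ hX) hD0
  have hcard : (Fintype.piFinset fun _ : Fin n => Finset.Ico (0 : ℤ) D).card
      < (Finset.range (D ^ n + 1)).card := by
    simp [Fintype.card_piFinset]
  obtain ⟨s, hs, t, ht, hst, hcell⟩ := Finset.exists_ne_map_eq_of_card_lt_of_maps_to hcard hmaps
  wlog hlt : s < t generalizing s t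
  · exact this t ht s hs hst.symm hcell.symm (lt_of_le_of_ne (not_lt.1 hlt) hst.symm)
  have happrox : ∀ j, |((t * w j) / X - (s * w j) / X) * X - ((t : ℤ) - s) * w j| * D < X := by
    intro j
    have h := congrFun hcell j
    simp only [cell] at h
    have e1 := Int.mul_ediv_add_emod (t * w j) X
    have e2 := Int.mul_ediv_add_emod (s * w j) X
    have f1 := Int.mul_ediv_add_emod ((t * w j) % X * D) X
    have f2 := Int.mul_ediv_add_emod ((s * w j) % X * D) X
    have g1 := Int.emod_nonneg ((t * w j) % X * D) hX.ne'
    have g2 := Int.emod_nonneg ((s * w j) % X * D) hX.ne'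
    have l1 := Int.emod_lt_of_pos ((t * w j) % X * D) hX
    have l2 := Int.emod_lt_of_pos ((s * w j) % X * D) hX
    have key : ((t * w j) / X - (s * w j) / X) * X - ((t : ℤ) - s) * w j
        = (s * w j) % X - (t * w j) % X := by linear_combination e1 - e2
    have habs : |(s * w j) % X - (t * w j) % X| * (D : ℤ)
        = |((s * w j) % X - (t * w j) % X) * D| := by rw [abs_mul, abs_of_pos hD0]
    rw [key, habs, sub_mul, abs_lt]
    rw [h] at f2
    constructor <;> linarith
  refine ⟨fun j => (t * w j) / X - (s * w j) / X, (t : ℤ) - s, ?_, by omega, ?_, happrox⟩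
  · ext i
    set p : Fin n → ℤ := fun j => (t * w j) / X - (s * w j) / X with hp
    have hwi : ∑ j, A i j * w j = 0 := congrFun hw i
    have hsum : (∑ j, A i j * p j) * X = ∑ j, A i j * (p j * X - ((t : ℤ) - s) * w j) := by
      have : ∑ j, A i j * (p j * X - ((t : ℤ) - s) * w j)
          = (∑ j, A i j * p j) * X - ((t : ℤ) - s) * ∑ j, A i j * w j := by
        rw [Finset.sum_mul, Finset.mul_sum, ← Finset.sum_sub_distrib]
        exact Finset.sum_congr rfl fun j _ => by ring
      rw [this, hwi, mul_zero, sub_zero]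
    -- As `A w = 0`, the integer `(A p) i` is only accumulated error, at most `n * Δ / D < 1`.
    have hle : |∑ j, A i j * p j| * X * D ≤ n * Δ * X := by
      calc |∑ j, A i j * p j| * X * D
          = |∑ j, A i j * (p j * X - ((t : ℤ) - s) * w j)| * D := by
            rw [← hsum, abs_mul, abs_of_pos hX]
        _ ≤ (∑ j, |A i j * (p j * X - ((t : ℤ) - s) * w j)|) * D :=
            mul_le_mul_of_nonneg_right (Finset.abs_sum_le_sum_abs _ _) hD0.le
        _ = ∑ j, |A i j| * (|p j * X - ((t : ℤ) - s) * w j| * D) := by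
            rw [Finset.sum_mul]
            exact Finset.sum_congr rfl fun j _ => by rw [abs_mul, mul_assoc]
        _ ≤ ∑ _j : Fin n, (Δ : ℤ) * X :=
            Finset.sum_le_sum fun j _ =>
              mul_le_mul (hA i j) (happrox j).le (by positivity) (by positivity)
        _ = n * Δ * X := by simp [mul_assoc]
    have hDz : (n : ℤ) * Δ < D := by exact_mod_cast hD
    have hzero : |∑ j, A i j * p j| < 1 := by
      by_contra hge
      have h1 : X * D ≤ |∑ j, A i j * p j| * (X * D) :=
        le_mul_of_one_le_left (by positivity) (not_lt.1 hge)
      nlinarith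
    exact Int.abs_lt_one_iff.1 hzero
  · have := Finset.mem_range.1 ht
    have h2 : (t : ℤ) ≤ (D : ℤ) ^ n := by exact_mod_cast Nat.lt_succ_iff.1 this
    omega

/-! ### Rigidity: truncated bit lengths determine a vertex -/

theorem lt_two_pow_of_size_min_eq {k l a b : ℕ} (hlk : l ≤ k)
    (h : (min a (2 ^ k)).size = (min b (2 ^ k)).size) (ha : a < 2 ^ l) : b < 2 ^ l := by
  by_contra hb
  have h1 : l < (min b (2 ^ k)).size :=
    Nat.lt_size.2 (le_min (not_lt.1 hb) (Nat.pow_le_pow_right (by norm_num) hlk))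
  rw [← h] at h1
  exact absurd ((Nat.lt_size.1 h1).trans (min_le_left _ _)) (not_le.2 ha)

theorem le_two_mul_of_size_min_eq {k a b : ℕ}
    (h : (min a (2 ^ k)).size = (min b (2 ^ k)).size) (ha : a < 2 ^ k) : b ≤ 2 * a := by
  have hb := lt_two_pow_of_size_min_eq le_rfl h ha
  rw [min_eq_left ha.le, min_eq_left hb.le] at h
  have hb' : b < 2 ^ a.size := h ▸ Nat.lt_size_self b
  rcases Nat.eq_zero_or_pos a with rfl | hpos
  · simp at hb'
    simp [hb']
  · have h1 : 0 < a.size := Nat.size_pos.2 hpos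
    have h2 : 2 ^ (a.size - 1) ≤ a := Nat.lt_size.1 (by omega)
    have h3 : 2 ^ a.size = 2 * 2 ^ (a.size - 1) := by
      rw [← pow_succ']
      congr 1
      omega
    omega

theorem eq_of_size_min_eq {m n : ℕ} {A : Matrix (Fin m) (Fin n) ℤ} {Δ d : ℕ}
    (hA : ∀ i j, |A i j| ≤ (Δ : ℤ)) (hd : n * Δ < 2 ^ d) (hd0 : 0 < d) {u v : Fin n → ℕ}
    (huv : A.mulVec (fun j => (u j : ℤ)) = A.mulVec (fun j => (v j : ℤ)))
    (hu : KernelFree A u)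
    (h : ∀ j, (min (u j) (2 ^ (d + 2 * (d * n)))).size
      = (min (v j) (2 ^ (d + 2 * (d * n)))).size) : u = v := by
  set k := d + 2 * (d * n) with hk
  set w : Fin n → ℤ := (fun j => (u j : ℤ)) - fun j => (v j : ℤ) with hwdef
  have hwj : ∀ j, w j = (u j : ℤ) - v j := fun j => rfl
  have hw : A.mulVec w = 0 := by rw [hwdef, Matrix.mulVec_sub, huv, sub_self]
  have hsmall : ∀ j, |w j| < 2 ^ k := by
    by_contra! hbig
    obtain ⟨j₁, hj₁⟩ := hbig
    obtain ⟨j₀, -, hj₀⟩ := Finset.exists_max_image Finset.univ (fun j => |w j|) ⟨j₁, Finset.mem_univ _⟩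
    set X := |w j₀| with hXdef
    have hXk : 2 ^ k ≤ X := hj₁.trans (hj₀ j₁ (Finset.mem_univ _))
    have hX : 0 < X := lt_of_lt_of_le (by positivity) hXk
    obtain ⟨p, q, hp, hq0, hq, happ⟩ := exists_kernel_approx (D := 2 ^ d) hA hd hw hX
    push_cast at hq happ
    have hD2 : (2 : ℤ) ≤ 2 ^ d := by
      calc (2 : ℤ) = 2 ^ 1 := by norm_num
        _ ≤ 2 ^ d := pow_le_pow_right₀ (by norm_num) hd0
    have hpq : ∀ j, |p j| ≤ q := by
      intro j
      have h1 : |p j| * X ≤ |p j * X - q * w j| + q * |w j| := by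
        rw [← abs_of_pos hX, ← abs_mul, ← abs_of_pos hq0, ← abs_mul, abs_of_pos hX, abs_of_pos hq0]
        calc |p j * X| = |(p j * X - q * w j) + q * w j| := by ring_nf
          _ ≤ _ := abs_add_le _ _
      have h2 : q * |w j| ≤ q * X := mul_le_mul_of_nonneg_left (hj₀ j (Finset.mem_univ _)) hq0.le
      have h3 : |p j * X - q * w j| < X := by
        nlinarith [happ j, abs_nonneg (p j * X - q * w j)]
      have h4 : |p j| * X < (q + 1) * X := by linarith
      exact Int.lt_add_one_iff.1 (lt_of_mul_lt_mul_right h4 hX.le)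
    -- Large `u j` dominate `q`, hence `|p j|`. For `u j < 2 ^ (d * n)`, both `q * |w j| / X` and
    -- the approximation error are at most `2 ^ (-d)`, by the choice of `k`, which forces `p j = 0`.
    have hp0 : p = 0 := by
      refine hu p hp fun j => ?_
      rcases lt_or_ge (u j) (2 ^ (d * n)) with hlt | hge
      · have hvlt : v j < 2 ^ (d * n) := lt_two_pow_of_size_min_eq (by omega) (h j) hlt
        have hwlt : |w j| < 2 ^ (d * n) := by
          have h1 : (u j : ℤ) < 2 ^ (d * n) := by exact_mod_cast hlt
          have h2 : (v j : ℤ) < 2 ^ (d * n) := by exact_mod_cast hvlt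
          rw [hwj, abs_lt]
          constructor <;> linarith [Int.natCast_nonneg (u j), Int.natCast_nonneg (v j)]
        have h1 : |p j| * X ≤ |p j * X - q * w j| + q * |w j| := by
          rw [← abs_of_pos hX, ← abs_mul, ← abs_of_pos hq0, ← abs_mul, abs_of_pos hX,
            abs_of_pos hq0]
          calc |p j * X| = |(p j * X - q * w j) + q * w j| := by ring_nf
            _ ≤ _ := abs_add_le _ _
        have h2 : q * |w j| ≤ 2 ^ (d * n) * 2 ^ (d * n) :=
          mul_le_mul (by rw [pow_mul]; exact hq) hwlt.le (abs_nonneg _) (by positivity)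
        have h3 : (2 : ℤ) ^ d * (2 ^ (d * n) * 2 ^ (d * n)) ≤ X := by
          rw [← pow_add, ← pow_add, ← two_mul]
          exact hXk
        have h4 : |p j| * X * 2 ^ d < X + X := by
          calc |p j| * X * 2 ^ d ≤ (|p j * X - q * w j| + q * |w j|) * 2 ^ d :=
                mul_le_mul_of_nonneg_right h1 (by positivity)
            _ = |p j * X - q * w j| * 2 ^ d + 2 ^ d * (q * |w j|) := by ring
            _ < X + X := add_lt_add_of_lt_of_le (happ j)
                ((mul_le_mul_of_nonneg_left h2 (by positivity)).trans h3)
        have h5 : |p j| < 1 := by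
          by_contra hge
          have : X * 2 ^ d ≤ |p j| * (X * 2 ^ d) :=
            le_mul_of_one_le_left (by positivity) (not_lt.1 hge)
          nlinarith
        rw [Int.abs_lt_one_iff.1 h5]
        simp
      · calc |p j| ≤ q := hpq j
          _ ≤ 2 ^ (d * n) := by rw [pow_mul]; exact hq
          _ ≤ (u j : ℤ) := by exact_mod_cast hge
    -- At the maximal entry `|w j₀| = X`, so `p j₀ = 0` would be an error of `q ≥ 1`.
    have h1 := happ j₀
    rw [hp0] at h1
    simp only [Pi.zero_apply, zero_mul, zero_sub, abs_neg, abs_mul, abs_of_pos hq0] at h1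
    rw [← hXdef] at h1
    have h2 : X ≤ q * X := le_mul_of_one_le_left hX.le hq0
    nlinarith
  have hw0 : w = 0 := by
    refine hu w hw fun j => ?_
    rcases lt_or_ge (u j) (2 ^ k) with hlt | hge
    · have := le_two_mul_of_size_min_eq (h j) hlt
      rw [hwj, abs_le]
      constructor <;> omega
    · have : ((2 : ℤ) ^ k) ≤ u j := by exact_mod_cast hge
      exact (hsmall j).le.trans this
  ext j
  have := congrFun hw0 j
  rw [hwj, Pi.zero_apply] at this
  omega

/-! ### Sparsity of vertices -/

/-- Two subsets of the support with equal column sums would differ by a kernel vector with entries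
in `{-1, 0, 1}`, dominated by `z`. -/
theorem two_pow_card_support_le {m n : ℕ} {A : Matrix (Fin m) (Fin n) ℤ} {Δ : ℕ}
    (hA : ∀ i j, |A i j| ≤ (Δ : ℤ)) {z : Fin n → ℕ} (hz : KernelFree A z) :
    2 ^ (Finset.univ.filter fun j => z j ≠ 0).card
      ≤ (2 * ((Finset.univ.filter fun j => z j ≠ 0).card * Δ) + 1) ^ m := by
  set S := Finset.univ.filter fun j => z j ≠ 0 with hS
  let ind : Finset (Fin n) → Fin n → ℤ := fun T j => if j ∈ T then 1 else 0
  have hmaps : ∀ T ∈ S.powerset, A.mulVec (ind T) ∈ Fintype.piFinset fun _ : Fin m =>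
      Finset.Icc (-((S.card * Δ : ℕ) : ℤ)) ((S.card * Δ : ℕ) : ℤ) := by
    intro T hT
    refine Fintype.mem_piFinset.2 fun i => Finset.mem_Icc.2 (abs_le.1 ?_)
    have h1 : A.mulVec (ind T) i = ∑ j ∈ T, A i j := by
      simp [Matrix.mulVec, dotProduct, ind]
    rw [h1]
    calc |∑ j ∈ T, A i j| ≤ ∑ j ∈ T, |A i j| := Finset.abs_sum_le_sum_abs _ _
      _ ≤ ∑ _j ∈ T, (Δ : ℤ) := Finset.sum_le_sum fun j _ => hA i j
      _ = ((T.card * Δ : ℕ) : ℤ) := by simp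
      _ ≤ ((S.card * Δ : ℕ) : ℤ) := by
          exact_mod_cast Nat.mul_le_mul_right _ (Finset.card_le_card (Finset.mem_powerset.1 hT))
  have hinj : Set.InjOn (fun T => A.mulVec (ind T)) (S.powerset : Set (Finset (Fin n))) := by
    intro T hT U hU hTU
    have hT' := Finset.mem_powerset.1 hT
    have hU' := Finset.mem_powerset.1 hU
    have h0 : ind T - ind U = 0 := by
      refine hz _ (by rw [Matrix.mulVec_sub]; exact sub_eq_zero.2 hTU) fun j => ?_
      by_cases hj : j ∈ S
      · have : z j ≠ 0 := (Finset.mem_filter.1 hj).2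
        have h1 : (1 : ℤ) ≤ z j := by exact_mod_cast Nat.one_le_iff_ne_zero.2 this
        refine le_trans ?_ h1
        simp only [ind, Pi.sub_apply]
        split_ifs <;> simp
      · have h1 : j ∉ T := fun h => hj (hT' h)
        have h2 : j ∉ U := fun h => hj (hU' h)
        simp [ind, h1, h2]
    ext j
    have := congrFun h0 j
    simp only [ind, Pi.sub_apply, Pi.zero_apply] at this
    by_cases h1 : j ∈ T <;> by_cases h2 : j ∈ U <;> simp_all
  have := Finset.card_le_card_of_injOn _ hmaps hinj
  rw [Finset.card_powerset, Fintype.card_piFinset, Finset.prod_const, Int.card_Icc,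
    Finset.card_univ, Fintype.card_fin] at this
  convert this using 2
  omega

theorem le_of_two_pow_le {m Δ y : ℕ} (hm : 2 ≤ m * Δ)
    (h : 2 ^ y ≤ (2 * (y * Δ) + 1) ^ m) : (y : ℝ) ≤ 8 * (m * Real.logb 2 (m * Δ)) := by
  have hm0 : 0 < m := Nat.pos_of_ne_zero (by rintro rfl; simp at hm)
  have hΔ0 : 0 < Δ := Nat.pos_of_ne_zero (by rintro rfl; simp at hm)
  have hmR : (0 : ℝ) < m := by exact_mod_cast hm0
  have hΔR : (0 : ℝ) < Δ := by exact_mod_cast hΔ0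
  have hm2 : (2 : ℝ) ≤ m * Δ := by exact_mod_cast hm
  have hl : 1 ≤ Real.logb 2 (m * Δ) := by
    rw [Real.le_logb_iff_rpow_le (by norm_num) (by positivity)]
    simpa using hm2
  rcases Nat.eq_zero_or_pos y with rfl | hy
  · simp only [Nat.cast_zero]
    positivity
  have hyR : (0 : ℝ) < y := by exact_mod_cast hy
  have h1 : 2 ^ y ≤ (3 * (y * Δ)) ^ m :=
    h.trans (Nat.pow_le_pow_left (by have := Nat.mul_pos hy hΔ0; omega) m)
  have h2 : (2 : ℝ) ^ y ≤ (3 * (y * Δ)) ^ m := by exact_mod_cast h1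
  have h3 : (y : ℝ) ≤ m * Real.logb 2 (3 * (y * Δ)) := by
    have := Real.logb_le_logb_of_le (b := 2) (by norm_num) (by positivity) h2
    rwa [Real.logb_pow, Real.logb_pow, Real.logb_self_eq_one (by norm_num), mul_one] at this
  -- This scaling gives `2 * x ≤ 3 + log (mΔ) + log x`, and `log x ≤ x` absorbs the last term.
  set x : ℝ := y / (2 * m) with hx
  have hx0 : 0 < x := by positivity
  have hyx : (y : ℝ) = 2 * m * x := by
    rw [hx]
    field_simp
  have hlx : Real.logb 2 x ≤ x := by
    have h4 := Real.log_le_sub_one_of_pos (half_pos hx0)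
    rw [Real.log_div hx0.ne' (by norm_num)] at h4
    rw [Real.logb, div_le_iff₀ (Real.log_pos (by norm_num))]
    nlinarith [Real.log_two_gt_d9, Real.log_two_lt_d9]
  have h6 : Real.logb 2 (3 * (y * Δ)) ≤ 3 + Real.logb 2 (m * Δ) + Real.logb 2 x := by
    have : (3 : ℝ) * (y * Δ) ≤ 2 ^ (3 : ℕ) * (m * Δ) * x := by
      rw [hyx]
      nlinarith [mul_pos (mul_pos hmR hΔR) hx0]
    refine (Real.logb_le_logb_of_le (b := 2) (by norm_num) (by positivity) this).trans_eq ?_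
    rw [Real.logb_mul (by positivity) hx0.ne', Real.logb_mul (by norm_num) (by positivity),
      Real.logb_pow, Real.logb_self_eq_one (by norm_num)]
    norm_num
  have h7 : 2 * x ≤ 3 + Real.logb 2 (m * Δ) + x := by
    have h8 : (m : ℝ) * (2 * x) ≤ m * (3 + Real.logb 2 (m * Δ) + x) := by
      calc (m : ℝ) * (2 * x) = y := by rw [hyx]; ring
        _ ≤ m * Real.logb 2 (3 * (y * Δ)) := h3
        _ ≤ _ := mul_le_mul_of_nonneg_left (by linarith) hmR.le
    exact le_of_mul_le_mul_left h8 hmR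
  have h9 : x ≤ 4 * Real.logb 2 (m * Δ) := by linarith
  calc (y : ℝ) = 2 * m * x := hyx
    _ ≤ 2 * m * (4 * Real.logb 2 (m * Δ)) := mul_le_mul_of_nonneg_left h9 (by positivity)
    _ = _ := by ring

/-! ### Counting -/

/-- Sparse bounded vectors: a set that injects into them is small. -/
theorem finite_and_ncard_le_of_sparse {α : Type*} {n s K : ℕ} (hn : 0 < n) (V : Set α)
    (f : α → Fin n → ℕ) (hinj : Set.InjOn f V) (hK : ∀ v ∈ V, ∀ j, f v j < K)
    (hs : ∀ v ∈ V, (Finset.univ.filter fun j => f v j ≠ 0).card ≤ s) :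
    V.Finite ∧ V.ncard ≤ (n * K) ^ s := by
  have : Nonempty (Fin n) := ⟨⟨0, hn⟩⟩
  have hex : ∀ v : V, ∃ e : Fin s → Fin n, ∀ j, f v j ≠ 0 → ∃ t, e t = j := by
    intro v
    let S := Finset.univ.filter fun j => f v j ≠ 0
    obtain ⟨g⟩ : Nonempty (S ↪ Fin s) :=
      Function.Embedding.nonempty_of_card_le (by simpa using hs v v.2)
    -- Unused slots get an arbitrary index; only covering the support matters.
    refine ⟨fun t => if h : ∃ x : S, g x = t then h.choose else Classical.arbitrary _,
      fun j hj => ⟨g ⟨j, Finset.mem_filter.2 ⟨Finset.mem_univ _, hj⟩⟩, ?_⟩⟩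
    have h : ∃ x : S, g x = g ⟨j, Finset.mem_filter.2 ⟨Finset.mem_univ _, hj⟩⟩ := ⟨_, rfl⟩
    refine (dif_pos h).trans ?_
    exact congrArg Subtype.val (g.injective h.choose_spec)
  choose e he using hex
  let F : V → (Fin s → Fin n × Fin K) := fun v t => (e v t, ⟨f v (e v t), hK v v.2 _⟩)
  have hF : Function.Injective F := by
    intro u v huv
    have h1 : ∀ t, e u t = e v t := fun t => congrArg Prod.fst (congrFun huv t)
    have h2 : ∀ t, f u (e u t) = f v (e v t) := fun t =>
      congrArg (fun x => (x.2 : ℕ)) (congrFun huv t)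
    refine Subtype.ext (hinj u.2 v.2 (funext fun j => ?_))
    by_cases hu : f u j = 0
    · by_cases hv : f v j = 0
      · rw [hu, hv]
      · obtain ⟨t, rfl⟩ := he v j hv
        rw [← h2, h1]
    · obtain ⟨t, rfl⟩ := he u j hu
      rw [h2, h1]
  have hfin : Finite V := Finite.of_injective F hF
  refine ⟨hfin, ?_⟩
  have := Nat.card_le_card_of_injective F hF
  simpa [Nat.card_eq_fintype_card] using this

theorem vertices_integerHull_finite_and_ncard_le {m n d s : ℕ} (hn : 0 < n)
    {A : Matrix (Fin m) (Fin n) ℤ} (b : Fin m → ℤ) {Δ : ℕ} (hA : ∀ i j, |A i j| ≤ (Δ : ℤ))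
    (hd : n * Δ < 2 ^ d) (hd0 : 0 < d)
    (hs : ∀ y : ℕ, 2 ^ y ≤ (2 * (y * Δ) + 1) ^ m → y ≤ s) :
    (vertices (integerHull (standardPolyhedron A b))).Finite ∧
      (vertices (integerHull (standardPolyhedron A b))).ncard
        ≤ (n * (d + 2 * (d * n) + 2)) ^ s := by
  set V := vertices (integerHull (standardPolyhedron A b))
  set k := d + 2 * (d * n)
  have hV : ∀ v : Fin n → ℝ, ∃ z : Fin n → ℕ, v ∈ V → v = (fun j => (z j : ℝ)) ∧
      A.mulVec (fun j => (z j : ℤ)) = b ∧ KernelFree A z := by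
    intro v
    by_cases hv : v ∈ V
    · obtain ⟨z, hz⟩ := exists_kernelFree_of_mem_vertices hv
      exact ⟨z, fun _ => hz⟩
    · exact ⟨0, fun h => absurd h hv⟩
  choose z hz using hV
  refine finite_and_ncard_le_of_sparse hn V (fun v j => (min (z v j) (2 ^ k)).size) ?_ ?_ ?_
  · intro u hu v hv huv
    obtain ⟨hu1, hu2, hu3⟩ := hz u hu
    obtain ⟨hv1, hv2, hv3⟩ := hz v hv
    rw [hu1, hv1, eq_of_size_min_eq hA hd hd0 (hu2.trans hv2.symm) hu3 (congrFun huv)]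
  · intro v _ j
    have : (min (z v j) (2 ^ k)).size ≤ (2 ^ k).size := Nat.size_le_size (min_le_right _ _)
    rw [Nat.size_pow] at this
    omega
  · intro v hv
    refine le_trans (Finset.card_le_card fun j hj => ?_)
      (hs _ (two_pow_card_support_le hA (hz v hv).2.2))
    simp only [Finset.mem_filter, Finset.mem_univ, true_and] at hj ⊢
    intro h0
    simp [h0] at hj

/-- The case `n = 1` is separate because the base of the final bound can then equal 1, leaving no
room for constants. -/
theorem vertices_integerHull_subsingleton {m : ℕ} {A : Matrix (Fin m) (Fin 1) ℤ}
    (hA : A ≠ 0) (b : Fin m → ℤ) :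
    (vertices (integerHull (standardPolyhedron A b))).Subsingleton := by
  intro u hu v hv
  obtain ⟨i, hi⟩ : ∃ i, A i 0 ≠ 0 := by
    by_contra! h
    exact hA (by ext i j; rw [Subsingleton.elim j 0]; exact h i)
  have h1 := congrFun (mem_of_mem_vertices_integerHull hu).1.1 i
  have h2 := congrFun (mem_of_mem_vertices_integerHull hv).1.1 i
  have h3 := h1.trans h2.symm
  have hi' : (A i 0 : ℝ) ≠ 0 := by exact_mod_cast hi
  simp only [Matrix.mulVec, dotProduct, Fin.sum_univ_one, Matrix.map_apply] at h3
  ext j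
  rw [Subsingleton.elim j 0]
  exact mul_left_cancel₀ hi' h3

theorem sparse_count_base_le {m n Δ : ℕ} (hn : 2 ≤ n) (hm : 2 ≤ m * Δ) :
    ∃ d : ℕ, 0 < d ∧ n * Δ < 2 ^ d ∧
      ((n * (d + 2 * (d * n) + 2) : ℕ) : ℝ) ≤ (n * m * Real.logb 2 (m * Δ)) ^ (7 : ℕ) := by
  have hm0 : 1 ≤ m := Nat.one_le_iff_ne_zero.2 (by rintro rfl; simp at hm)
  have hΔ0 : 1 ≤ Δ := Nat.one_le_iff_ne_zero.2 (by rintro rfl; simp at hm)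
  have hmR : (1 : ℝ) ≤ m := by exact_mod_cast hm0
  have hΔR : (1 : ℝ) ≤ Δ := by exact_mod_cast hΔ0
  have hnR : (2 : ℝ) ≤ n := by exact_mod_cast hn
  have hm2 : (2 : ℝ) ≤ m * Δ := by exact_mod_cast hm
  set l := Real.logb 2 (m * Δ) with hl
  have hl1 : 1 ≤ l := by
    rw [hl, Real.le_logb_iff_rpow_le (by norm_num) (by positivity)]
    simpa using hm2
  have hnΔ : n * Δ ≠ 0 := by positivity
  refine ⟨Nat.log 2 (n * Δ) + 1, by omega, Nat.lt_pow_succ_log_self (by norm_num) _, ?_⟩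
  set g := Nat.log 2 (n * Δ)
  have hg : (g : ℝ) ≤ n + l := by
    have h1 : ((2 : ℝ) ^ g) ≤ n * Δ := by exact_mod_cast Nat.pow_log_le_self 2 hnΔ
    have h2 : (n : ℝ) * Δ ≤ 2 ^ n * (m * Δ) := by
      have h3 : (n : ℝ) ≤ 2 ^ n := by exact_mod_cast Nat.lt_two_pow_self.le
      have h4 : (Δ : ℝ) ≤ m * Δ := le_mul_of_one_le_left (by positivity) hmR
      exact mul_le_mul h3 h4 (by positivity) (by positivity)
    have h5 := Real.logb_le_logb_of_le (b := 2) (by norm_num) (by positivity) (h1.trans h2)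
    rwa [Real.logb_mul (by positivity) (by positivity), Real.logb_pow, Real.logb_pow,
      Real.logb_self_eq_one (by norm_num), mul_one, mul_one] at h5
  have hnl : (n : ℝ) + l ≤ 2 * (n * l) := by nlinarith
  have hnl2 : (2 : ℝ) ≤ n * l := by nlinarith
  have hBnl : (n : ℝ) * l ≤ n * m * l := by nlinarith [mul_nonneg (by positivity : (0 : ℝ) ≤ n) (by linarith : (0 : ℝ) ≤ l)]
  have hBn : (n : ℝ) ≤ n * m * l := le_trans (by nlinarith) hBnl
  set B := (n : ℝ) * m * l
  have hB2 : 2 ≤ B := hnR.trans hBn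
  have hd : ((g : ℝ) + 1) ≤ 3 * B := by linarith
  push_cast
  have e1 : ((g : ℝ) + 1) + 2 * ((g + 1) * n) + 2 ≤ 3 * B + 2 * (3 * B * B) + B := by
    have : ((g : ℝ) + 1) * n ≤ 3 * B * B := mul_le_mul hd hBn (by positivity) (by positivity)
    linarith
  calc (n : ℝ) * (((g : ℝ) + 1) + 2 * ((g + 1) * n) + 2)
      ≤ B * (3 * B + 2 * (3 * B * B) + B) := mul_le_mul hBn e1 (by positivity) (by positivity)
    _ ≤ B * (2 ^ 4 * (B * B)) := by
        refine mul_le_mul_of_nonneg_left ?_ (by positivity)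
        nlinarith
    -- Here `B ≥ 2`, which needs `n ≥ 2`, absorbs the constant.
    _ ≤ B * (B ^ 4 * (B * B)) := by gcongr
    _ = B ^ 7 := by ring

theorem logb_le_two_mul_logb_sqrt_mul {m Δ : ℕ} (hm : 2 ≤ m * Δ) :
    Real.logb 2 (m * Δ) ≤ 2 * Real.logb 2 (Real.sqrt m * Δ) := by
  have hm0 : 1 ≤ m := Nat.one_le_iff_ne_zero.2 (by rintro rfl; simp at hm)
  have hΔ0 : 1 ≤ Δ := Nat.one_le_iff_ne_zero.2 (by rintro rfl; simp at hm)
  have hmR : (1 : ℝ) ≤ m := by exact_mod_cast hm0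
  have hΔR : (1 : ℝ) ≤ Δ := by exact_mod_cast hΔ0
  have h1 : (m : ℝ) * Δ ≤ (Real.sqrt m * Δ) ^ 2 := by
    rw [mul_pow, Real.sq_sqrt (by positivity)]
    nlinarith [mul_nonneg (by positivity : (0 : ℝ) ≤ m * Δ) (sub_nonneg.2 hΔR)]
  have h2 := Real.logb_le_logb_of_le (b := 2) (by norm_num) (by positivity) h1
  rw [Real.logb_pow] at h2
  exact_mod_cast h2

theorem mainTheorem6 :
    ∃ C : ℝ, 0 < C ∧
      ∀ (m n : ℕ) (A : Matrix (Fin m) (Fin n) ℤ) (b : Fin m → ℤ),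
        2 ≤ m * maxAbsEntry A →
        (vertices (integerHull (standardPolyhedron A b))).Finite ∧
        ((vertices (integerHull (standardPolyhedron A b))).ncard : ℝ) ≤
          ((n : ℝ) * (m : ℝ) * Real.logb 2 ((m : ℝ) * (maxAbsEntry A : ℝ))) ^
            (C * ((m : ℝ) * Real.logb 2 (Real.sqrt (m : ℝ) * (maxAbsEntry A : ℝ)))) := by
  -- `112 = 7 * 8 * 2`: power of the base, support bound, and passage from `mΔ` to `√m Δ`.
  refine ⟨112, by norm_num, fun m n A b hm => ?_⟩
  have hlog := logb_le_two_mul_logb_sqrt_mul hm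
  have hA := abs_le_maxAbsEntry A
  have hA0 : A ≠ 0 := by
    rintro rfl
    have h0 : maxAbsEntry (0 : Matrix (Fin m) (Fin n) ℤ) = 0 :=
      Nat.le_zero.1 (Finset.sup_le fun i _ => Finset.sup_le fun j _ => by simp)
    simp [h0] at hm
  set Δ := maxAbsEntry A
  have hm0 : 1 ≤ m := Nat.one_le_iff_ne_zero.2 (by rintro rfl; simp at hm)
  have hmR : (1 : ℝ) ≤ m := by exact_mod_cast hm0
  have hm2 : (2 : ℝ) ≤ m * Δ := by exact_mod_cast hm
  have hl1 : 1 ≤ Real.logb 2 (m * Δ) := by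
    rw [Real.le_logb_iff_rpow_le (by norm_num) (by positivity)]
    simpa using hm2
  have hexp : 0 ≤ 112 * ((m : ℝ) * Real.logb 2 (Real.sqrt m * Δ)) := by
    have : 0 ≤ Real.logb 2 (Real.sqrt m * Δ) := by linarith
    positivity
  have hmul : ∀ {N : ℝ}, 1 ≤ N → 1 ≤ N * m * Real.logb 2 (m * Δ) := fun hN =>
    one_le_mul_of_one_le_of_one_le (one_le_mul_of_one_le_of_one_le hN hmR) hl1
  obtain rfl | rfl | hn : n = 0 ∨ n = 1 ∨ 2 ≤ n := by omega
  · exact absurd (by ext i j; exact j.elim0) hA0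
  · have hsub := vertices_integerHull_subsingleton hA0 b
    refine ⟨hsub.finite, le_trans ?_ (Real.one_le_rpow (hmul (by norm_num)) hexp)⟩
    have := hsub.finite.to_subtype
    exact_mod_cast Set.ncard_le_one_iff_subsingleton.2 hsub
  · obtain ⟨d, hd0, hd, hbase⟩ := sparse_count_base_le hn hm
    obtain ⟨hfin, hcard⟩ := vertices_integerHull_finite_and_ncard_le (d := d)
      (s := ⌊8 * (m * Real.logb 2 (m * Δ))⌋₊) (by omega) b hA hd hd0
      (fun y hy => Nat.le_floor (le_of_two_pow_le hm hy))
    refine ⟨hfin, ?_⟩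
    set s := ⌊8 * (m * Real.logb 2 (m * Δ))⌋₊
    have hs : (s : ℝ) ≤ 8 * (m * Real.logb 2 (m * Δ)) := Nat.floor_le (by positivity)
    have hn1 : (1 : ℝ) ≤ n := by exact_mod_cast (by omega : 1 ≤ n)
    have hB := hmul hn1
    set B := (n : ℝ) * m * Real.logb 2 (m * Δ)
    calc ((vertices (integerHull (standardPolyhedron A b))).ncard : ℝ)
        ≤ (((n * (d + 2 * (d * n) + 2)) ^ s : ℕ) : ℝ) := by exact_mod_cast hcard
      _ = ((n * (d + 2 * (d * n) + 2) : ℕ) : ℝ) ^ s := by rw [Nat.cast_pow]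
      _ ≤ (B ^ 7) ^ s := pow_le_pow_left₀ (by positivity) hbase s
      _ = B ^ ((7 * s : ℕ) : ℝ) := by rw [← pow_mul, Real.rpow_natCast]
      _ ≤ B ^ (112 * ((m : ℝ) * Real.logb 2 (Real.sqrt m * Δ))) := by
          refine Real.rpow_le_rpow_of_exponent_le hB ?_
          push_cast
          have := mul_le_mul_of_nonneg_left hlog (by positivity : (0 : ℝ) ≤ m)
          linarith
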